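/- A finite graph is called integral if all eigenvalues of its adjacency matrix are integers, and the nullity of a finite graph is the dimension of the kernel of its adjacency matrix (equivalently, the multiplicity of $0$ as an eigenvalue). Up to isomorphism, there is exactly one integral tree with nullity $2$, namely the tree on six vertices obtained from a single edge $uv$ by attaching two new leaves to $u$ and two new leaves to $v$. That is, a finite graph $G$ is a tree, is integral and has nullity $2$ if and only if $G$ is isomorphic to this six-vertex tree. -/

import Mathlib

/-- A finite graph is integral if every eigenvalue of its adjacency matrix, i.e. every zero of its
characteristic polynomial, is an integer. (The matrix is real symmetric, so all zeros of the
characteristic polynomial are real.) -/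
def SimpleGraph.IsIntegralGraph {V : Type*} [Fintype V] [DecidableEq V] (G : SimpleGraph V)
    [DecidableRel G.Adj] : Prop :=
  ∀ x : ℝ, (G.adjMatrix ℝ).charpoly.IsRoot x → ∃ z : ℤ, x = (z : ℝ)

/-- The nullity of a finite graph: the dimension of the kernel of its adjacency matrix over `ℝ`. -/
noncomputable def SimpleGraph.nullity {V : Type*} [Fintype V] [DecidableEq V] (G : SimpleGraph V)
    [DecidableRel G.Adj] : ℕ :=
  Module.finrank ℝ (LinearMap.ker (Matrix.toLin' (G.adjMatrix ℝ)))

/-- The tree on six vertices consisting of two adjacent vertices `0` and `1`, with two leaves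
`2`, `3` attached to `0` and two leaves `4`, `5` attached to `1`. -/
def sixVertexTree : SimpleGraph (Fin 6) :=
  SimpleGraph.fromEdgeSet {s(0, 1), s(0, 2), s(0, 3), s(1, 4), s(1, 5)}

/-! Let `A` be the adjacency matrix. König's theorem for trees gives an independent set `U` with `#U
= #Uᶜ + 2`. Independence allows at most `#Uᶜ` negative eigenvalues, so at least `#Uᶜ` are positive,
and by integrality these are at least 1. Thus `A - 1` is nonnegative on a space of dimension `#Uᶜ`,
while it is `-1` on `U`. By inertia its Schur complement on `Uᶜ` is positive semidefinite
(`quadraticForm_nonneg_of_eigenvalues`); its diagonal is the degree into `U` minus 1, and off the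
diagonal it counts common neighbours in `U` plus adjacency.

Semidefiniteness forces every vertex outside `U` to have at least two neighbours in `U`, and the
edge count of a tree leaves an excess of exactly one edge (`IsTree.exists_indep_schurNonneg`). If
this edge lies inside `Uᶜ`, a test vector and acyclicity leave only the six-vertex tree. Otherwise
one vertex `o` has three neighbours in `U`, and the tree is `o` with neighbours `d₁`, `d₂`, `d₃` and
with `p` and `q` pendant paths of length two at `d₁` and `d₂`. Its eigenvalues are not all integers:
`p = q` would make `p + 1` and `p + 3` both squares, and `p ≠ q` would give a square `y` with `(y -
(p + 2)) * (y - (q + 2)) = 1`. -/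

section

open Finset
open scoped Matrix

/-! ### König's theorem for trees via the nullity -/

namespace SimpleGraph

variable {V : Type*} {G : SimpleGraph V}

/-- The vertex set of a subforest has a vertex with at most one neighbour in it. -/
lemma IsTree.exists_mem_forall_adj_eq (hG : G.IsTree) {W : Finset V} (hW : W.Nonempty) :
    ∃ u ∈ W, ∃ v, ∀ w ∈ W, G.Adj u w → w = v := by
  classical
  obtain ⟨r⟩ := hG.connected.nonempty
  -- For `u` farthest from the root `r`, a neighbour in `W` must be nearer to `r`, hence be the
  -- parent of `u`.
  obtain ⟨u, hu, hmax⟩ := W.exists_max_image (fun u => G.dist r u) hW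
  obtain ⟨p, hp, -⟩ := hG.existsUnique_path r u
  refine ⟨u, hu, p.penultimate, fun w hw huw => ?_⟩
  have hd : G.dist r u = G.dist r w + 1 := by
    have := hG.dist_eq_dist_add_one_of_adj r huw
    have := hmax w hw
    omega
  obtain ⟨q, hq, hql⟩ := (hG.connected r w).exists_path_of_dist
  refine hG.isAcyclic.eq_penultimate_of_adj_end hp huw ?_
  have hun : u ∉ q.support := fun h => by
    have h1 := dist_le (q.takeUntil u h)
    have h2 := q.length_takeUntil_le_length h
    omega
  have hqp : (q.concat huw.symm).IsPath := hq.concat hun huw.symm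
  have : q.concat huw.symm = p := (hG.existsUnique_path r u).unique hqp hp
  rw [← this, Walk.support_concat]
  simp

variable [Fintype V] [DecidableRel G.Adj]

variable (G) in
/-- The kernel of the adjacency matrix of the subgraph induced on `W`, its vectors being extended
by zero to all vertices. -/
def supportedKernel (W : Finset V) : Submodule ℝ (V → ℝ) where
  carrier := {z | (∀ v ∉ W, z v = 0) ∧ ∀ v ∈ W, (G.adjMatrix ℝ).mulVec z v = 0}
  add_mem' := by
    rintro a b ⟨ha, ha'⟩ ⟨hb, hb'⟩
    exact ⟨fun v hv => by simp [ha v hv, hb v hv],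
      fun v hv => by rw [Matrix.mulVec_add, Pi.add_apply, ha' v hv, hb' v hv, add_zero]⟩
  zero_mem' := by simp
  smul_mem' := by
    rintro c a ⟨ha, ha'⟩
    exact ⟨fun v hv => by simp [ha v hv],
      fun v hv => by rw [Matrix.mulVec_smul, Pi.smul_apply, ha' v hv, smul_zero]⟩

lemma mem_supportedKernel {W : Finset V} {z : V → ℝ} : z ∈ G.supportedKernel W ↔
    (∀ v ∉ W, z v = 0) ∧ ∀ v ∈ W, (G.adjMatrix ℝ).mulVec z v = 0 := Iff.rfl

lemma adjMatrix_mulVec_apply_eq_sum (v : V) (z : V → ℝ) :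
    (G.adjMatrix ℝ).mulVec z v = ∑ w, if G.Adj v w then z w else 0 := by
  rw [adjMatrix_mulVec_apply, neighborFinset_eq_filter, sum_filter]

variable [DecidableEq V]

lemma supportedKernel_univ :
    G.supportedKernel univ = LinearMap.ker (Matrix.toLin' (G.adjMatrix ℝ)) := by
  ext z
  simp [mem_supportedKernel, funext_iff]

lemma finrank_supportedKernel_le_of_isolated {W : Finset V} {u : V} (hu : u ∈ W)
    (h : ∀ w ∈ W, ¬ G.Adj u w) :
    Module.finrank ℝ (G.supportedKernel W) ≤
      Module.finrank ℝ (G.supportedKernel (W.erase u)) + 1 := by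
  have key : ∀ z ∈ G.supportedKernel W, Function.update z u 0 ∈ G.supportedKernel (W.erase u) := by
    rintro z ⟨hz, hz'⟩
    refine ⟨fun v hv => ?_, fun v hv => ?_⟩
    · by_cases hvu : v = u
      · simp [hvu]
      · simpa [hvu] using hz v (by simpa [hvu] using hv)
    · refine Eq.trans ?_ (hz' v (mem_of_mem_erase hv))
      rw [adjMatrix_mulVec_apply_eq_sum,
        adjMatrix_mulVec_apply_eq_sum]
      refine sum_congr rfl fun w _ => ?_
      by_cases hwu : w = u
      · subst hwu
        rw [if_neg fun h' => h v (mem_of_mem_erase hv) h'.symm,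
          if_neg fun h' => h v (mem_of_mem_erase hv) h'.symm]
      · simp [hwu]
  let f : G.supportedKernel W →ₗ[ℝ] G.supportedKernel (W.erase u) × ℝ :=
    { toFun := fun z => (⟨Function.update z.1 u 0, key z.1 z.2⟩, z.1 u)
      map_add' := fun a b => by
        ext v
        · by_cases hv : v = u <;> simp [hv]
        · simp
      map_smul' := fun c a => by
        ext v
        · by_cases hv : v = u <;> simp [hv]
        · simp }
  have hf : Function.Injective f := by
    intro a b hab
    ext v
    simp only [f, LinearMap.coe_mk, AddHom.coe_mk, Prod.mk.injEq, Subtype.mk.injEq] at hab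
    by_cases hv : v = u
    · rw [hv]; exact hab.2
    · simpa [hv] using congrFun hab.1 v
  simpa using LinearMap.finrank_le_finrank_of_injective hf

/-- The kernel equation at the leaf `u` forces `z v = 0`, and the equation at `v` recovers `z u`
from the other coordinates; so forgetting both loses nothing. -/
lemma finrank_supportedKernel_le_of_leaf {W : Finset V} {u v : V} (hu : u ∈ W) (hv : v ∈ W)
    (huv : G.Adj u v) (h : ∀ w ∈ W, G.Adj u w → w = v) :
    Module.finrank ℝ (G.supportedKernel W) ≤
      Module.finrank ℝ (G.supportedKernel ((W.erase u).erase v)) := by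
  have hzv : ∀ z ∈ G.supportedKernel W, z v = 0 := by
    rintro z ⟨hz, hz'⟩
    rw [← hz' u hu, adjMatrix_mulVec_apply_eq_sum, sum_eq_single v]
    · simp [huv]
    · intro w _ hwv
      split_ifs with hw
      · exact hz w fun hwW => hwv (h w hwW hw)
      · rfl
    · simp
  have key : ∀ z ∈ G.supportedKernel W,
      Function.update z u 0 ∈ G.supportedKernel ((W.erase u).erase v) := by
    intro z hzW
    obtain ⟨hz, hz'⟩ := id hzW
    refine ⟨fun w hw => ?_, fun w hw => ?_⟩
    · by_cases hwu : w = u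
      · simp [hwu]
      · by_cases hwv : w = v
        · subst hwv
          simpa [hwu] using hzv z hzW
        · simpa [hwu] using hz w (by simpa [hwu, hwv] using hw)
    · simp only [mem_erase] at hw
      refine Eq.trans ?_ (hz' w hw.2.2)
      rw [adjMatrix_mulVec_apply_eq_sum, adjMatrix_mulVec_apply_eq_sum]
      refine sum_congr rfl fun x _ => ?_
      by_cases hxu : x = u
      · subst hxu
        rw [if_neg fun h' => hw.1 (h w hw.2.2 h'.symm), if_neg fun h' => hw.1 (h w hw.2.2 h'.symm)]
      · simp [hxu]
  let f : G.supportedKernel W →ₗ[ℝ] G.supportedKernel ((W.erase u).erase v) :=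
    { toFun := fun z => ⟨Function.update z.1 u 0, key z.1 z.2⟩
      map_add' := fun a b => by
        ext w
        by_cases hw : w = u <;> simp [hw]
      map_smul' := fun c a => by
        ext w
        by_cases hw : w = u <;> simp [hw] }
  have hf : Function.Injective f := by
    rw [← LinearMap.ker_eq_bot, LinearMap.ker_eq_bot']
    rintro ⟨z, hzW⟩ hz0
    have h0 : ∀ w, w ≠ u → z w = 0 := fun w hw => by
      have := congrArg (fun t => t.1 w) hz0
      simpa [f, hw] using this
    have hzu : z u = 0 := by
      rw [← hzW.2 v hv, adjMatrix_mulVec_apply_eq_sum, sum_eq_single u]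
      · simp [huv.symm]
      · intro w _ hw
        simp [h0 w hw]
      · simp
    ext w
    by_cases hw : w = u
    · subst hw; exact hzu
    · exact h0 w hw
  exact LinearMap.finrank_le_finrank_of_injective hf

/-- Greedy choice: put an isolated vertex or a leaf into `U` and delete it, together with the
neighbour of the leaf. Either way `2 * #U` grows by 2, which covers the lost vertices and the
possible drop in nullity. -/
lemma IsTree.exists_indep_subset (hG : G.IsTree) (W : Finset V) :
    ∃ U ⊆ W, (∀ u ∈ U, ∀ v ∈ U, ¬ G.Adj u v) ∧
      #W + Module.finrank ℝ (G.supportedKernel W) ≤ 2 * #U := by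
  induction W using Finset.strongInduction with
  | H W ih =>
  rcases W.eq_empty_or_nonempty with rfl | hW
  · refine ⟨∅, subset_rfl, by simp, ?_⟩
    have : G.supportedKernel (∅ : Finset V) = ⊥ := by
      rw [eq_bot_iff]
      intro z hz
      ext v
      exact hz.1 v (by simp)
    rw [this]
    simp
  obtain ⟨u, hu, v, huv⟩ := hG.exists_mem_forall_adj_eq hW
  by_cases hiso : ∀ w ∈ W, ¬ G.Adj u w
  · obtain ⟨U, hUW, hU, hc⟩ := ih _ (erase_ssubset hu)
    have huU : u ∉ U := fun h => by simpa using hUW h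
    refine ⟨insert u U, ?_, ?_, ?_⟩
    · exact insert_subset hu (hUW.trans (erase_subset _ _))
    · have h1 : ∀ w ∈ U, ¬ G.Adj u w := fun w hw => hiso w (mem_of_mem_erase (hUW hw))
      intro a ha b hb
      rw [mem_insert] at ha hb
      rcases ha with rfl | ha <;> rcases hb with rfl | hb
      · simp
      · exact h1 b hb
      · exact fun h => h1 a ha h.symm
      · exact hU a ha b hb
    · have := finrank_supportedKernel_le_of_isolated hu hiso
      rw [card_insert_of_notMem huU]
      have := card_erase_add_one hu
      omega
  · push Not at hiso
    obtain ⟨w, hw, huw⟩ := hiso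
    obtain rfl := huv w hw huw
    have hwe : w ∈ W.erase u := mem_erase.2 ⟨huw.ne', hw⟩
    obtain ⟨U, hUW, hU, hc⟩ := ih ((W.erase u).erase w)
      ((erase_ssubset hwe).trans (erase_ssubset hu))
    have huU : u ∉ U := fun h => by simpa using hUW h
    refine ⟨insert u U, ?_, ?_, ?_⟩
    · exact insert_subset hu (hUW.trans ((erase_subset _ _).trans (erase_subset _ _)))
    · have h1 : ∀ x ∈ U, ¬ G.Adj u x := fun x hx hux => by
        have h2 := hUW hx
        simp only [mem_erase] at h2
        exact h2.1 (huv x h2.2.2 hux)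
      intro a ha b hb
      rw [mem_insert] at ha hb
      rcases ha with rfl | ha <;> rcases hb with rfl | hb
      · simp
      · exact h1 b hb
      · exact fun h => h1 a ha h.symm
      · exact hU a ha b hb
    · have := finrank_supportedKernel_le_of_leaf hu hw huw huv
      rw [card_insert_of_notMem huU]
      have := card_erase_add_one hu
      have := card_erase_add_one hwe
      omega

/-- König's theorem for trees, in terms of the nullity. -/
theorem IsTree.exists_indep_card_add_nullity_le (hG : G.IsTree) :
    ∃ U : Finset V, (∀ u ∈ U, ∀ v ∈ U, ¬ G.Adj u v) ∧ Fintype.card V + G.nullity ≤ 2 * #U := by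
  obtain ⟨U, -, hU, hc⟩ := hG.exists_indep_subset univ
  rw [supportedKernel_univ] at hc
  exact ⟨U, hU, hc⟩

end SimpleGraph

/-! ### Inertia and eigenvalue counts -/

/-- The quadratic form of a real symmetric matrix in coordinates along eigenvectors. -/
lemma Matrix.IsHermitian.exists_eigencoordinates {V : Type*} [Fintype V] [DecidableEq V]
    {A : Matrix V V ℝ} (hA : A.IsHermitian) :
    ∃ c : (V → ℝ) →ₗ[ℝ] (V → ℝ), ∀ z : V → ℝ,
      z ⬝ᵥ z = ∑ i, c z i ^ 2 ∧ z ⬝ᵥ A.mulVec z = ∑ i, hA.eigenvalues i * c z i ^ 2 := by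
  set B : Matrix V V ℝ := (hA.eigenvectorUnitary : Matrix V V ℝ) with hB
  have hBB : B * Bᵀ = 1 := by
    have := Unitary.coe_mul_star_self hA.eigenvectorUnitary
    rwa [Unitary.coe_star, Matrix.star_eq_conjTranspose,
      Matrix.conjTranspose_eq_transpose_of_trivial] at this
  have hAB : A = B * Matrix.diagonal hA.eigenvalues * Bᵀ := by
    have := hA.spectral_theorem
    rw [Unitary.conjStarAlgAut_apply] at this
    conv_lhs => rw [this]
    rfl
  refine ⟨Bᵀ.mulVecLin, fun z => ⟨?_, ?_⟩⟩
  · have : z ⬝ᵥ z = z ⬝ᵥ (B * Bᵀ).mulVec z := by rw [hBB, Matrix.one_mulVec]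
    rw [this, ← Matrix.mulVec_mulVec, Matrix.dotProduct_mulVec, ← Matrix.mulVec_transpose]
    exact sum_congr rfl fun i _ => (sq _).symm
  · have : z ⬝ᵥ A.mulVec z = z ⬝ᵥ (B * Matrix.diagonal hA.eigenvalues * Bᵀ).mulVec z := by
      rw [← hAB]
    rw [this, mul_assoc, ← Matrix.mulVec_mulVec, Matrix.dotProduct_mulVec, ← Matrix.mulVec_transpose,
      ← Matrix.mulVec_mulVec, dotProduct]
    refine sum_congr rfl fun i _ => ?_
    rw [Matrix.mulVec_diagonal, Matrix.mulVecLin_apply]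
    ring

namespace SimpleGraph

variable {V : Type*} [Fintype V] [DecidableEq V] {G : SimpleGraph V} [DecidableRel G.Adj]

lemma card_eigenvalues_ne_zero_add_nullity :
    #{i | (G.isHermitian_adjMatrix ℝ).eigenvalues i ≠ 0} + G.nullity = Fintype.card V := by
  have h1 := (G.isHermitian_adjMatrix ℝ).rank_eq_card_non_zero_eigs
  have h2 := LinearMap.finrank_range_add_finrank_ker (Matrix.toLin' (G.adjMatrix ℝ))
  rw [Module.finrank_fintype_fun_eq_card] at h2
  rw [Fintype.card_subtype] at h1
  rw [← h1, ← h2]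
  rfl

lemma dotProduct_adjMatrix_mulVec_eq_zero {U : Finset V} (hU : ∀ u ∈ U, ∀ v ∈ U, ¬ G.Adj u v)
    {z : V → ℝ} (hz : ∀ v ∉ U, z v = 0) : z ⬝ᵥ (G.adjMatrix ℝ).mulVec z = 0 := by
  refine sum_eq_zero fun v _ => ?_
  by_cases hv : v ∈ U
  · rw [adjMatrix_mulVec_apply, sum_eq_zero, mul_zero]
    intro w hw
    exact hz w fun hwU => hU v hv w hwU (by simpa using hw)
  · rw [hz v hv, zero_mul]

/-- An independent set bounds the number of negative eigenvalues. -/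
lemma card_eigenvalues_neg_add_card_le {U : Finset V} (hU : ∀ u ∈ U, ∀ v ∈ U, ¬ G.Adj u v) :
    #{i | (G.isHermitian_adjMatrix ℝ).eigenvalues i < 0} + #U ≤ Fintype.card V := by
  by_contra! hlt
  obtain ⟨c, hc⟩ := (G.isHermitian_adjMatrix ℝ).exists_eigencoordinates
  set l := (G.isHermitian_adjMatrix ℝ).eigenvalues
  -- A vector in the kernel of `f` is supported on `U` and has coordinates only along negative
  -- eigenvalues. Its quadratic form is zero by independence and negative unless the vector is zero.
  let f : (V → ℝ) →ₗ[ℝ] ({v // v ∉ U} → ℝ) × ({i // ¬ l i < 0} → ℝ) :=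
    (LinearMap.funLeft ℝ ℝ Subtype.val).prod ((LinearMap.funLeft ℝ ℝ Subtype.val).comp c)
  have hdim : Module.finrank ℝ (({v // v ∉ U} → ℝ) × ({i // ¬ l i < 0} → ℝ)) <
      Module.finrank ℝ (V → ℝ) := by
    simp only [Module.finrank_prod, Module.finrank_fintype_fun_eq_card]
    have h1 := Fintype.card_subtype_compl (fun v => v ∈ U)
    have h2 := Fintype.card_subtype_compl (fun i => l i < 0)
    rw [Fintype.card_coe] at h1
    rw [Fintype.card_subtype (fun i => l i < 0)] at h2
    have := card_le_univ U
    have := card_le_univ {i | l i < 0}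
    omega
  obtain ⟨z, hz, hz0⟩ := (Submodule.ne_bot_iff _).1 (LinearMap.ker_ne_bot_of_finrank_lt hdim (f := f))
  have hz1 : ∀ v ∉ U, z v = 0 := fun v hv => congrFun (congrArg Prod.fst hz) ⟨v, hv⟩
  have hz2 : ∀ i, ¬ l i < 0 → c z i = 0 := fun i hi => congrFun (congrArg Prod.snd hz) ⟨i, hi⟩
  have hsum : ∑ i, l i * c z i ^ 2 = 0 := by
    rw [← (hc z).2, dotProduct_adjMatrix_mulVec_eq_zero hU hz1]
  have hcz : ∀ i, c z i = 0 := by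
    intro i
    by_contra hi
    have hneg : ∀ j ∈ univ, l j * c z j ^ 2 ≤ 0 := fun j _ => by
      by_cases hj : l j < 0
      · exact mul_nonpos_of_nonpos_of_nonneg hj.le (sq_nonneg _)
      · simp [hz2 j hj]
    have hi' := (sum_eq_zero_iff_of_nonpos hneg).1 hsum i (mem_univ i)
    rcases mul_eq_zero.1 hi' with h | h
    · exact hi (hz2 i (by simp [h]))
    · exact hi (by simpa using h)
  apply hz0
  have := (hc z).1
  simp only [hcz] at this
  exact dotProduct_self_eq_zero.1 (by simpa using this)

/-- The vertices outside of an independent set of the size given by König's theorem carry a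
positive semidefinite form, if no eigenvalue lies strictly between `0` and `1`. -/
theorem quadraticForm_nonneg_of_eigenvalues {U : Finset V}
    (hU : ∀ u ∈ U, ∀ v ∈ U, ¬ G.Adj u v) (hcard : Fintype.card V + G.nullity ≤ 2 * #U)
    (hint : ∀ i, 0 < (G.isHermitian_adjMatrix ℝ).eigenvalues i →
      1 ≤ (G.isHermitian_adjMatrix ℝ).eigenvalues i)
    {x : V → ℝ} (hx : ∀ u ∈ U, x u = 0) :
    0 ≤ ∑ u ∈ U, (G.adjMatrix ℝ).mulVec x u ^ 2 + x ⬝ᵥ (G.adjMatrix ℝ).mulVec x - x ⬝ᵥ x := by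
  by_contra! hlt
  have hneg := card_eigenvalues_neg_add_card_le hU
  have hnull := G.card_eigenvalues_ne_zero_add_nullity
  obtain ⟨c, hc⟩ := (G.isHermitian_adjMatrix ℝ).exists_eigencoordinates
  set l := (G.isHermitian_adjMatrix ℝ).eigenvalues
  set A := G.adjMatrix ℝ with hA
  -- Among vectors `x + w` with `w` supported on `U`, the form of `A - 1` is largest at `w = x'`,
  -- where it equals the Schur form of `x`. For `y` supported on `U`, its value at `y + t • (x +
  -- x')` is `t ^ 2` times the Schur form minus `y ⬝ᵥ y`.
  set x' : V → ℝ := fun v => if v ∈ U then A.mulVec x v else 0 with hx'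
  let g : ((V → ℝ) × ℝ) →ₗ[ℝ] (V → ℝ) :=
    LinearMap.fst ℝ _ _ + (LinearMap.snd ℝ (V → ℝ) ℝ).smulRight (x + x')
  let f : ((V → ℝ) × ℝ) →ₗ[ℝ] ({v // v ∉ U} → ℝ) × ({i // ¬ 0 < l i} → ℝ) :=
    ((LinearMap.funLeft ℝ ℝ Subtype.val).comp (LinearMap.fst ℝ _ _)).prod
      (((LinearMap.funLeft ℝ ℝ Subtype.val).comp c).comp g)
  have hcount : #{i | l i ≠ 0} = #{i | l i < 0} + #{i | 0 < l i} := by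
    rw [← card_union_of_disjoint]
    · congr 1
      ext i
      simp [lt_or_lt_iff_ne]
    · rw [disjoint_filter]
      intro i _ h1 h2
      exact lt_asymm h1 h2
  -- There are at least `#Uᶜ` positive eigenvalues, so the extra coordinate `t` makes the source
  -- larger than the target.
  have hdim : Module.finrank ℝ (({v // v ∉ U} → ℝ) × ({i // ¬ 0 < l i} → ℝ)) <
      Module.finrank ℝ ((V → ℝ) × ℝ) := by
    simp only [Module.finrank_prod, Module.finrank_fintype_fun_eq_card, Module.finrank_self]
    have h1 := Fintype.card_subtype_compl (fun v => v ∈ U)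
    have h2 := Fintype.card_subtype_compl (fun i => 0 < l i)
    rw [Fintype.card_coe] at h1
    rw [Fintype.card_subtype (fun i => 0 < l i)] at h2
    have := card_le_univ U
    have := card_le_univ {i | 0 < l i}
    omega
  obtain ⟨⟨y, t⟩, hz, hz0⟩ :=
    (Submodule.ne_bot_iff _).1 (LinearMap.ker_ne_bot_of_finrank_lt hdim (f := f))
  have hy : ∀ v ∉ U, y v = 0 := fun v hv => congrFun (congrArg Prod.fst hz) ⟨v, hv⟩
  set z : V → ℝ := y + t • (x + x') with hzdef
  have hz2 : ∀ i, ¬ 0 < l i → c z i = 0 := fun i hi => congrFun (congrArg Prod.snd hz) ⟨i, hi⟩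
  have hge : z ⬝ᵥ z ≤ z ⬝ᵥ A.mulVec z := by
    rw [(hc z).1, (hc z).2]
    refine sum_le_sum fun i _ => ?_
    by_cases hi : 0 < l i
    · nlinarith [hint i hi, sq_nonneg (c z i)]
    · simp [hz2 i hi]
  set w : V → ℝ := y + t • x' with hw
  have hwz : z = w + t • x := by
    rw [hzdef, hw, smul_add]; abel
  have hwU : ∀ v ∉ U, w v = 0 := fun v hv => by simp [hw, hx', hv, hy v hv]
  have h1 : w ⬝ᵥ A.mulVec w = 0 := dotProduct_adjMatrix_mulVec_eq_zero hU hwU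
  have h2 : w ⬝ᵥ x = 0 := sum_eq_zero fun v _ => by
    by_cases hv : v ∈ U
    · simp [hx v hv]
    · simp [hwU v hv]
  have h3 : x ⬝ᵥ A.mulVec w = w ⬝ᵥ A.mulVec x := by
    rw [Matrix.dotProduct_mulVec, ← Matrix.mulVec_transpose, hA, transpose_adjMatrix,
      dotProduct_comm]
  have h4 : w ⬝ᵥ A.mulVec x = w ⬝ᵥ x' := sum_congr rfl fun v _ => by
    by_cases hv : v ∈ U
    · simp [hx', hv]
    · simp [hwU v hv]
  have h5 : x' ⬝ᵥ x' = ∑ u ∈ U, A.mulVec x u ^ 2 := by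
    rw [dotProduct, ← sum_subset (subset_univ U)]
    · exact sum_congr rfl fun v hv => by simp [hx', hv, sq]
    · intro v _ hv
      simp [hx', hv]
  have h6 : y ⬝ᵥ y = w ⬝ᵥ w - 2 * t * (w ⬝ᵥ x') + t ^ 2 * (x' ⬝ᵥ x') := by
    have : y = w - t • x' := by rw [hw]; abel
    rw [this, sub_dotProduct, dotProduct_sub, dotProduct_sub, smul_dotProduct, dotProduct_smul,
      smul_dotProduct, dotProduct_smul, dotProduct_comm x' w]
    simp only [smul_eq_mul]
    ring
  have hkey : t ^ 2 * (∑ u ∈ U, A.mulVec x u ^ 2 + x ⬝ᵥ A.mulVec x - x ⬝ᵥ x) - y ⬝ᵥ y ≥ 0 := by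
    rw [hwz, Matrix.mulVec_add, Matrix.mulVec_smul] at hge
    simp only [add_dotProduct, dotProduct_add, smul_dotProduct, dotProduct_smul, smul_eq_mul,
      h1, h2, h3, h4, dotProduct_comm x w] at hge
    rw [h6, ← h5]
    nlinarith
  have hyy : 0 ≤ y ⬝ᵥ y := sum_nonneg fun v _ => mul_self_nonneg _
  have ht : t = 0 := by
    by_contra ht
    have := mul_neg_of_pos_of_neg (by positivity : 0 < t ^ 2) hlt
    linarith
  subst ht
  have : y = 0 := dotProduct_self_eq_zero.1 (by nlinarith)
  exact hz0 (by simp [this])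

end SimpleGraph

lemma Matrix.isRoot_charpoly_iff_exists_mulVec_eq_smul {n K : Type*} [Fintype n] [DecidableEq n]
    [Field K] {A : Matrix n n K} {r : K} :
    A.charpoly.IsRoot r ↔ ∃ z ≠ 0, A *ᵥ z = r • z := by
  rw [Polynomial.IsRoot, Matrix.eval_charpoly, ← Matrix.exists_mulVec_eq_zero_iff]
  refine exists_congr fun z => and_congr_right fun _ => ?_
  rw [Matrix.sub_mulVec, sub_eq_zero, eq_comm]
  simp

/-! ### The Schur complement and the degree count -/

namespace SimpleGraph

variable {V : Type*} {G : SimpleGraph V} {U : Finset V} {s t : V}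

/-- Distinct vertices that are adjacent or have a common neighbour in `U`. -/
def Linked (G : SimpleGraph V) (U : Finset V) (s t : V) : Prop :=
  s ≠ t ∧ (G.Adj s t ∨ ∃ u ∈ U, G.Adj s u ∧ G.Adj t u)

lemma Linked.symm (h : G.Linked U s t) : G.Linked U t s :=
  ⟨h.1.symm, h.2.imp (fun h => h.symm) fun ⟨u, hu, h1, h2⟩ => ⟨u, hu, h2, h1⟩⟩

/-- In a connected graph, linked vertices connect the complement of an independent set. -/
lemma Connected.induction_linked (hG : G.Connected) (hU : ∀ u ∈ U, ∀ v ∈ U, ¬ G.Adj u v)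
    {P : V → Prop} {s : V} (hs : s ∉ U) (hP : P s)
    (h : ∀ a b, a ∉ U → b ∉ U → P a → G.Linked U a b → P b) (t : V) :
    (t ∉ U → P t) ∧ (t ∈ U → ∃ a ∉ U, P a ∧ G.Adj a t) := by
  obtain ⟨w⟩ := hG.preconnected t s
  -- A vertex of `U` records a neighbour outside `U` where `P` holds, so that leaving `U` again
  -- along the walk is a single link.
  induction w with
  | nil => exact ⟨fun _ => hP, fun h => absurd h hs⟩
  | @cons a b c hab p ih =>
    obtain ⟨h1, h2⟩ := ih hs hP
    refine ⟨fun ha => ?_, fun ha => ?_⟩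
    · by_cases hb : b ∈ U
      · obtain ⟨c, hc, hPc, hcb⟩ := h2 hb
        by_cases hca : c = a
        · exact hca ▸ hPc
        · exact h c a hc ha hPc ⟨hca, Or.inr ⟨b, hb, hcb, hab⟩⟩
      · exact h b a hb ha (h1 hb) ⟨hab.ne', Or.inl hab.symm⟩
    · have hb : b ∉ U := fun hb => hU a ha b hb hab
      exact ⟨b, hb, h1 hb, hab.symm⟩

variable [DecidableRel G.Adj]

variable (G) in
/-- The number of neighbours of `s` in `U`. -/
def degreeIn (U : Finset V) (s : V) : ℕ := #{u ∈ U | G.Adj s u}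

variable [DecidableEq V]

variable (G) in
/-- The Schur complement of `-1`, indexed by `U`, in `A - 1`, where `A` is the adjacency matrix and
`U` is independent. -/
def schurEntry (U : Finset V) (s t : V) : ℝ :=
  #{u ∈ U | G.Adj s u ∧ G.Adj t u} + (if G.Adj s t then 1 else 0) - if s = t then 1 else 0

variable (G) in
/-- Positive semidefiniteness of the Schur complement, on the vertices outside of `U`. -/
def SchurNonneg (U : Finset V) : Prop :=
  ∀ (k : ℕ) (f : Fin k → V) (a : Fin k → ℝ), (∀ i, f i ∉ U) →
    0 ≤ ∑ i, ∑ j, a i * a j * G.schurEntry U (f i) (f j)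

lemma schurEntry_comm : G.schurEntry U s t = G.schurEntry U t s := by
  simp only [schurEntry, adj_comm, and_comm, eq_comm]

lemma schurEntry_self : G.schurEntry U s s = G.degreeIn U s - 1 := by
  simp [schurEntry, degreeIn]

lemma Linked.one_le_schurEntry (h : G.Linked U s t) : 1 ≤ G.schurEntry U s t := by
  rw [schurEntry, if_neg h.1, sub_zero]
  rcases h.2 with h | ⟨u, hu, h1, h2⟩
  · rw [if_pos h]
    linarith [(Nat.cast_nonneg #{u ∈ U | G.Adj s u ∧ G.Adj t u} : (0 : ℝ) ≤ _)]
  · have h3 : 0 < #{u ∈ U | G.Adj s u ∧ G.Adj t u} := card_pos.2 ⟨u, by simp [hu, h1, h2]⟩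
    have h4 : (1 : ℝ) ≤ #{u ∈ U | G.Adj s u ∧ G.Adj t u} := by exact_mod_cast h3
    split_ifs <;> linarith

lemma schurEntry_eq_zero (hst : s ≠ t) (h : ¬ G.Linked U s t) : G.schurEntry U s t = 0 := by
  have h1 : ¬ G.Adj s t := fun h' => h ⟨hst, Or.inl h'⟩
  have h2 : #{u ∈ U | G.Adj s u ∧ G.Adj t u} = 0 := by
    rw [card_eq_zero, filter_eq_empty_iff]
    exact fun u hu h' => h ⟨hst, Or.inr ⟨u, hu, h'⟩⟩
  simp [schurEntry, h1, h2, hst]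

/-- A semidefinite matrix cannot have a nonpositive diagonal entry in a row with a nonzero entry. -/
lemma SchurNonneg.two_le_degreeIn (hM : G.SchurNonneg U) (hs : s ∉ U) (ht : t ∉ U)
    (h : G.Linked U s t) : 2 ≤ G.degreeIn U s := by
  by_contra! hlt
  have h1 : G.schurEntry U s s ≤ 0 := by
    rw [schurEntry_self]
    have : (G.degreeIn U s : ℝ) ≤ 1 := by exact_mod_cast Nat.lt_succ_iff.1 hlt
    linarith
  have h2 : -1 ≤ G.schurEntry U t t := by
    rw [schurEntry_self]
    linarith [(Nat.cast_nonneg (G.degreeIn U t) : (0 : ℝ) ≤ _)]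
  have h3 := h.one_le_schurEntry
  -- With `d` the entry at `t, t`, the form is at most `-2 * (d + 2) + d = -d - 4`, which is
  -- negative because `d ≥ -1`.
  have h4 := hM 2 ![s, t] ![-(G.schurEntry U t t + 2), 1] (by intro i; fin_cases i <;> simpa)
  simp only [Fin.sum_univ_two, Matrix.cons_val_zero, Matrix.cons_val_one,
    G.schurEntry_comm (s := t) (t := s)] at h4
  nlinarith [mul_nonneg (by linarith : 0 ≤ G.schurEntry U t t + 2)
    (by linarith : 0 ≤ G.schurEntry U s t - 1), mul_nonneg (sq_nonneg (G.schurEntry U t t + 2))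
    (by linarith : 0 ≤ - G.schurEntry U s s)]

variable [Fintype V]

lemma IsIntegralGraph.exists_int_of_mulVec_eq (hG : G.IsIntegralGraph) {z : V → ℝ} (hz : z ≠ 0)
    {r : ℝ} (h : G.adjMatrix ℝ *ᵥ z = r • z) : ∃ k : ℤ, r = k :=
  hG r (Matrix.isRoot_charpoly_iff_exists_mulVec_eq_smul.2 ⟨z, hz, h⟩)

lemma IsIntegralGraph.one_le_eigenvalues (hG : G.IsIntegralGraph) (i : V)
    (hi : 0 < (G.isHermitian_adjMatrix ℝ).eigenvalues i) :
    1 ≤ (G.isHermitian_adjMatrix ℝ).eigenvalues i := by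
  obtain ⟨k, hk⟩ := hG _ (Matrix.mem_spectrum_iff_isRoot_charpoly.1
    ((G.isHermitian_adjMatrix ℝ).eigenvalues_mem_spectrum_real i))
  rw [hk] at hi ⊢
  have : 0 < k := by exact_mod_cast hi
  exact_mod_cast this

lemma schurForm_eq (x : V → ℝ) :
    ∑ u ∈ U, (G.adjMatrix ℝ).mulVec x u ^ 2 + x ⬝ᵥ (G.adjMatrix ℝ).mulVec x - x ⬝ᵥ x =
      ∑ s, ∑ t, x s * x t * G.schurEntry U s t := by
  have h1 : ∑ u ∈ U, (G.adjMatrix ℝ).mulVec x u ^ 2 =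
      ∑ s, ∑ t, x s * x t * #{u ∈ U | G.Adj s u ∧ G.Adj t u} := by
    have h (u : V) : (G.adjMatrix ℝ).mulVec x u ^ 2 =
        ∑ s, ∑ t, x s * x t * if G.Adj s u ∧ G.Adj t u then 1 else 0 := by
      rw [adjMatrix_mulVec_apply_eq_sum, sq, sum_mul_sum]
      refine sum_congr rfl fun s _ => sum_congr rfl fun t _ => ?_
      simp only [G.adj_comm u]
      split_ifs <;> simp_all
    rw [sum_congr rfl fun u _ => h u, sum_comm]
    refine sum_congr rfl fun s _ => ?_
    rw [sum_comm]
    refine sum_congr rfl fun t _ => ?_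
    rw [← mul_sum, sum_boole]
  have h2 : x ⬝ᵥ (G.adjMatrix ℝ).mulVec x =
      ∑ s, ∑ t, x s * x t * if G.Adj s t then 1 else 0 := by
    simp only [dotProduct, adjMatrix_mulVec_apply_eq_sum, mul_sum]
    refine sum_congr rfl fun s _ => sum_congr rfl fun t _ => ?_
    split_ifs <;> simp
  have h3 : x ⬝ᵥ x = ∑ s, ∑ t, x s * x t * if s = t then 1 else 0 := by
    simp [dotProduct]
  rw [h1, h2, h3, ← sum_add_distrib, ← sum_sub_distrib]
  refine sum_congr rfl fun s _ => ?_
  rw [← sum_add_distrib, ← sum_sub_distrib]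
  refine sum_congr rfl fun t _ => ?_
  rw [schurEntry]
  ring

lemma schurNonneg_of_isIntegralGraph (hG : G.IsIntegralGraph)
    (hU : ∀ u ∈ U, ∀ v ∈ U, ¬ G.Adj u v) (hcard : Fintype.card V + G.nullity ≤ 2 * #U) :
    G.SchurNonneg U := by
  intro k f a hf
  -- The family `f` may repeat vertices, so coefficients are summed over its fibres.
  set x : V → ℝ := fun s => ∑ i, if s = f i then a i else 0 with hx
  have hxU : ∀ u ∈ U, x u = 0 := fun u hu =>
    sum_eq_zero fun i _ => if_neg (by rintro rfl; exact hf i hu)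
  have key : ∀ g : V → ℝ, ∑ s, x s * g s = ∑ i, a i * g (f i) := fun g => by
    simp only [hx, sum_mul]
    rw [sum_comm]
    simp
  have h := quadraticForm_nonneg_of_eigenvalues hU hcard hG.one_le_eigenvalues hxU
  rw [schurForm_eq] at h
  simp only [mul_assoc, ← mul_sum] at h ⊢
  rw [key] at h
  simpa only [key] using h

/-- If `z` and `A z` vanish off `U`, then `A z = 0`, because the neighbours of a vertex of `U` lie
off `U`. These are `2 * #Uᶜ` linear conditions. The bound is the converse of the König inequality.
-/
lemma card_le_two_mul_card_compl_add_nullity (hU : ∀ u ∈ U, ∀ v ∈ U, ¬ G.Adj u v) :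
    Fintype.card V ≤ 2 * #Uᶜ + G.nullity := by
  let g : (V → ℝ) →ₗ[ℝ] ({v // v ∉ U} → ℝ) := LinearMap.funLeft ℝ ℝ Subtype.val
  let f : (V → ℝ) →ₗ[ℝ] ({v // v ∉ U} → ℝ) × ({v // v ∉ U} → ℝ) :=
    g.prod (g.comp (Matrix.toLin' (G.adjMatrix ℝ)))
  have hker : LinearMap.ker f ≤ LinearMap.ker (Matrix.toLin' (G.adjMatrix ℝ)) := by
    intro z hz
    have h1 : ∀ v ∉ U, z v = 0 := fun v hv => congrFun (congrArg Prod.fst hz) ⟨v, hv⟩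
    have h2 : ∀ v ∉ U, (G.adjMatrix ℝ *ᵥ z) v = 0 := fun v hv =>
      congrFun (congrArg Prod.snd hz) ⟨v, hv⟩
    rw [LinearMap.mem_ker, Matrix.toLin'_apply]
    ext v
    by_cases hv : v ∈ U
    · rw [adjMatrix_mulVec_apply, Pi.zero_apply]
      exact sum_eq_zero fun w hw => h1 w fun hwU => hU v hv w hwU (by simpa using hw)
    · exact h2 v hv
  have h1 := LinearMap.finrank_range_add_finrank_ker f
  have h2 := Submodule.finrank_le (LinearMap.range f)
  have h3 := Submodule.finrank_mono hker
  simp only [Module.finrank_prod, Module.finrank_fintype_fun_eq_card] at h1 h2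
  rw [Fintype.card_subtype_compl, Fintype.card_coe, ← card_compl] at h2
  change _ ≤ G.nullity at h3
  omega

lemma sum_degreeIn_eq_sum_degree (hU : ∀ u ∈ U, ∀ v ∈ U, ¬ G.Adj u v) :
    ∑ s ∈ Uᶜ, G.degreeIn U s = ∑ u ∈ U, G.degree u := by
  have h := sum_card_bipartiteAbove_eq_sum_card_bipartiteBelow G.Adj (s := Uᶜ) (t := U)
  refine h.trans (sum_congr rfl fun u hu => ?_)
  rw [← card_neighborFinset_eq_degree, neighborFinset_eq_filter, bipartiteBelow]
  congr 1
  ext v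
  simp only [mem_filter, mem_compl, mem_univ, true_and, G.adj_comm v]
  exact ⟨fun h => h.2, fun h => ⟨fun hv => hU u hu v hv h, h⟩⟩

lemma degree_eq_degreeIn_add : G.degree s = G.degreeIn U s + G.degreeIn Uᶜ s := by
  rw [← card_neighborFinset_eq_degree, neighborFinset_eq_filter, degreeIn, degreeIn,
    ← card_union_of_disjoint (disjoint_filter_filter disjoint_compl_right), ← filter_union,
    union_compl]

/-- The sum is twice the number of edges: `degreeIn Uᶜ` already sees each edge inside `Uᶜ` from both
ends, whereas `degreeIn U` sees each crossing edge once. -/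
lemma IsTree.sum_degreeIn (hG : G.IsTree) (hU : ∀ u ∈ U, ∀ v ∈ U, ¬ G.Adj u v) :
    ∑ s ∈ Uᶜ, (2 * G.degreeIn U s + G.degreeIn Uᶜ s) + 2 = 2 * Fintype.card V := by
  have h1 := hG.card_edgeFinset
  have h2 := G.sum_degrees_eq_twice_card_edges
  rw [← sum_add_sum_compl U, ← sum_degreeIn_eq_sum_degree hU, ← sum_add_distrib] at h2
  rw [sum_congr rfl (g := fun s => G.degreeIn U s + G.degree s)
    fun s _ => by rw [G.degree_eq_degreeIn_add (U := U)]; ring]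
  omega

/-- The structure of an integral tree of nullity two around a maximum independent set. -/
theorem IsTree.exists_indep_schurNonneg (hG : G.IsTree) (hint : G.IsIntegralGraph)
    (hnull : G.nullity = 2) :
    ∃ U : Finset V, (∀ u ∈ U, ∀ v ∈ U, ¬ G.Adj u v) ∧ G.SchurNonneg U ∧ #U = #Uᶜ + 2 ∧
      (∀ s ∉ U, 2 ≤ G.degreeIn U s) ∧
      ∑ s ∈ Uᶜ, (2 * (G.degreeIn U s - 2) + G.degreeIn Uᶜ s) = 2 := by
  obtain ⟨U, hU, hcard⟩ := hG.exists_indep_card_add_nullity_le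
  have hM := schurNonneg_of_isIntegralGraph hint hU hcard
  have hle := card_le_two_mul_card_compl_add_nullity hU
  have hc := card_add_card_compl U
  have hUc : #U = #Uᶜ + 2 := by omega
  have hdeg : ∀ s ∉ U, 2 ≤ G.degreeIn U s := by
    intro s hs
    by_cases hex : ∃ t ∉ U, G.Linked U s t
    · obtain ⟨t, ht, hst⟩ := hex
      exact hM.two_le_degreeIn hs ht hst
    -- With nothing linked to `s`, connectedness makes every vertex of `U` a neighbour of `s`, and
    -- `U` has at least two elements.
    · push Not at hex
      have key := hG.connected.induction_linked hU (P := fun t => t = s) hs rfl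
        (fun a b _ hb ha hab => absurd (ha ▸ hab) (hex b hb))
      have h1 : {u ∈ U | G.Adj s u} = U := filter_true_of_mem fun u hu => by
        obtain ⟨a, -, rfl, ha⟩ := (key u).2 hu
        exact ha
      rw [degreeIn, h1]
      omega
  refine ⟨U, hU, hM, hUc, hdeg, ?_⟩
  have hsum := hG.sum_degreeIn hU
  have : ∑ s ∈ Uᶜ, (2 * G.degreeIn U s + G.degreeIn Uᶜ s) =
      ∑ s ∈ Uᶜ, (2 * (G.degreeIn U s - 2) + G.degreeIn Uᶜ s) + 4 * #Uᶜ := by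
    rw [mul_comm 4, ← smul_eq_mul, ← sum_const, ← sum_add_distrib]
    refine sum_congr rfl fun s hs => ?_
    have := hdeg s (mem_compl.1 hs)
    omega
  omega

end SimpleGraph

/-! ### One edge outside `U`: the six-vertex tree -/

namespace SimpleGraph

section Acyclic

variable {V : Type*} {G : SimpleGraph V}

lemma IsAcyclic.walk_eq_of_isPath (hG : G.IsAcyclic) {a b : V} {p q : G.Walk a b} (hp : p.IsPath)
    (hq : q.IsPath) : p = q :=
  congrArg Subtype.val ((hG.subsingleton_path a b).elim ⟨p, hp⟩ ⟨q, hq⟩)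

lemma IsAcyclic.eq_of_common_neighbors (hG : G.IsAcyclic) {a b u v : V} (hab : a ≠ b)
    (hau : G.Adj a u) (hub : G.Adj u b) (hav : G.Adj a v) (hvb : G.Adj v b) : u = v := by
  have h := hG.walk_eq_of_isPath (p := .cons hau (.cons hub .nil)) (q := .cons hav (.cons hvb .nil))
    (by simp [hau.ne, hub.ne, hab]) (by simp [hav.ne, hvb.ne, hab])
  have := congrArg Walk.support h
  simpa using this

lemma IsAcyclic.not_adj_of_common_neighbor (hG : G.IsAcyclic) {a b u : V}
    (hau : G.Adj a u) (hub : G.Adj u b) : ¬ G.Adj a b := fun hab => by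
  have h := hG.walk_eq_of_isPath (p := .cons hau (.cons hub .nil)) (q := .cons hab .nil)
    (by simp [hau.ne, hub.ne, hab.ne]) (by simp [hab.ne])
  simpa using congrArg Walk.length h

/-- A forest has no cycle of length five. -/
lemma IsAcyclic.not_adj_of_path_four (hG : G.IsAcyclic) {a w t v b : V} (haw : G.Adj a w)
    (hwt : G.Adj w t) (htv : G.Adj t v) (hvb : G.Adj v b) (hat : a ≠ t) (htb : t ≠ b) :
    ¬ G.Adj a b := fun hab => by
  have hwv : w ≠ v := fun h => hG.not_adj_of_common_neighbor haw (h ▸ hvb) hab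
  have hav : a ≠ v := by
    rintro rfl
    exact hG.not_adj_of_common_neighbor haw hwt htv.symm
  have hwb : w ≠ b := by
    rintro rfl
    exact hG.not_adj_of_common_neighbor hwt htv hvb.symm
  have h := hG.walk_eq_of_isPath (p := .cons haw (.cons hwt (.cons htv (.cons hvb .nil))))
    (q := .cons hab .nil)
    (by simp [haw.ne, hwt.ne, htv.ne, hvb.ne, hab.ne, hat, htb, hwv, hav, hwb]) (by simp [hab.ne])
  simpa using congrArg Walk.length h

/-- A forest has no cycle of length six. -/
lemma IsAcyclic.eq_of_path_four (hG : G.IsAcyclic) {a w t v b u : V} (haw : G.Adj a w)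
    (hwt : G.Adj w t) (htv : G.Adj t v) (hvb : G.Adj v b) (hau : G.Adj a u) (hub : G.Adj u b)
    (hat : a ≠ t) (htb : t ≠ b) (hab : a ≠ b) : u = v := by
  by_cases hwv : w = v
  · exact hG.eq_of_common_neighbors hab hau hub (hwv ▸ haw) hvb
  have hav : a ≠ v := by
    rintro rfl
    exact hG.not_adj_of_common_neighbor haw hwt htv.symm
  have hwb : w ≠ b := by
    rintro rfl
    exact hG.not_adj_of_common_neighbor hwt htv hvb.symm
  have h := hG.walk_eq_of_isPath (p := .cons haw (.cons hwt (.cons htv (.cons hvb .nil))))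
    (q := .cons hau (.cons hub .nil))
    (by simp [haw.ne, hwt.ne, htv.ne, hvb.ne, hab, hat, htb, hwv, hav, hwb])
    (by simp [hau.ne, hub.ne, hab])
  simpa using congrArg Walk.length h

end Acyclic

variable {V : Type*} [DecidableEq V] {G : SimpleGraph V} [DecidableRel G.Adj]
  {U : Finset V} {s t : V}

/-- If `b` were linked to both `s` and `t`, a cycle of length three or five would arise. If it is
linked to `s` alone, the vector `(-1, 1, 1)` gives at most `3 - 2 - 2 < 0`. -/
lemma SchurNonneg.not_linked_of_adj (hM : G.SchurNonneg U) (hG : G.IsAcyclic)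
    (hdeg : ∀ s ∉ U, G.degreeIn U s = 2) {b : V} (hs : s ∉ U) (ht : t ∉ U) (hb : b ∉ U)
    (hst : G.Adj s t) (hsb : ¬ G.Adj s b) (htb : ¬ G.Adj t b) (hbt : t ≠ b) :
    ¬ G.Linked U s b := fun h => by
  have h0 : ¬ G.Linked U t b := fun h' => by
    obtain ⟨u, -, hsu, hbu⟩ := h.2.resolve_left hsb
    obtain ⟨w, -, htw, hbw⟩ := h'.2.resolve_left htb
    exact hG.not_adj_of_path_four hsu hbu.symm hbw htw.symm h.1 hbt.symm hst
  have h1 := h.one_le_schurEntry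
  have h2 := Linked.one_le_schurEntry (G := G) (U := U) ⟨hst.ne, Or.inl hst⟩
  have h3 := schurEntry_eq_zero hbt h0
  have h4 := hM 3 ![s, t, b] ![-1, 1, 1] (by intro i; fin_cases i <;> simpa)
  simp only [Fin.sum_univ_three, Matrix.cons_val_zero, Matrix.cons_val_one, Matrix.cons_val,
    schurEntry_self, hdeg s hs, hdeg t ht, hdeg b hb, h3, G.schurEntry_comm (s := t) (t := s),
    G.schurEntry_comm (s := b) (t := s), G.schurEntry_comm (s := b) (t := t)] at h4
  norm_num at h4
  linarith

lemma exists_filter_adj_eq_pair (h : G.degreeIn U s = 2) :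
    ∃ a b, a ∈ U ∧ b ∈ U ∧ a ≠ b ∧ G.Adj s a ∧ G.Adj s b ∧ ∀ u ∈ U, G.Adj s u → u = a ∨ u = b := by
  obtain ⟨a, b, hab, h⟩ := card_eq_two.1 h
  have key : ∀ u, u ∈ U ∧ G.Adj s u ↔ u = a ∨ u = b := fun u => by
    rw [← mem_filter, h, mem_insert, mem_singleton]
  have ha := (key a).2 (Or.inl rfl)
  have hb := (key b).2 (Or.inr rfl)
  exact ⟨a, b, ha.1, hb.1, hab, ha.2, hb.2, fun u hu hsu => (key u).1 ⟨hu, hsu⟩⟩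

variable [Fintype V]

/-- The degree sum 2 means a single edge `st` outside `U`. No further vertex outside `U` is linked
to its ends, so connectedness gives `Uᶜ = {s, t}`. -/
theorem IsTree.nonempty_iso_sixVertexTree (hG : G.IsTree)
    (hU : ∀ u ∈ U, ∀ v ∈ U, ¬ G.Adj u v) (hM : G.SchurNonneg U) (hcard : #U = #Uᶜ + 2)
    (hdeg : ∀ s ∉ U, G.degreeIn U s = 2) (hsum : ∑ s ∈ Uᶜ, G.degreeIn Uᶜ s = 2) :
    Nonempty (G ≃g sixVertexTree) := by
  have hpos : ∀ {x y}, x ∉ U → y ∉ U → G.Adj x y → 1 ≤ G.degreeIn Uᶜ x := fun {x y} _ hy hxy =>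
    card_pos.2 ⟨y, by simp [hy, hxy]⟩
  obtain ⟨s, hs, hs0⟩ : ∃ s ∈ Uᶜ, G.degreeIn Uᶜ s ≠ 0 := exists_ne_zero_of_sum_ne_zero (by omega)
  obtain ⟨t, ht'⟩ := card_ne_zero.1 hs0
  obtain ⟨ht, hst⟩ := mem_filter.1 ht'
  clear ht'
  rw [mem_compl] at hs ht
  have honly : ∀ x y, x ∉ U → y ∉ U → G.Adj x y → x = s ∨ x = t := by
    intro x y hx hy hxy
    by_contra! hne
    have h1 : ∑ a ∈ ({x, s, t} : Finset V), G.degreeIn Uᶜ a ≤ ∑ a ∈ Uᶜ, G.degreeIn Uᶜ a :=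
      sum_le_sum_of_subset (by
        intro a ha
        simp only [mem_insert, mem_singleton] at ha
        rcases ha with rfl | rfl | rfl <;> simpa)
    rw [sum_insert (by simp [hne]), sum_pair hst.ne] at h1
    have := hpos hx hy hxy
    have := hpos hs ht hst
    have := hpos ht hs hst.symm
    omega
  have key := hG.connected.induction_linked hU (P := fun x => x = s ∨ x = t) hs (Or.inl rfl) (by
    intro a b ha hb hP hab
    by_contra! hne
    have h1 : ∀ c, c ∉ U → ¬ G.Adj c b := fun c hc hcb => by
      rcases honly b c hb hc hcb.symm with h | h
      exacts [hne.1 h, hne.2 h]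
    rcases hP with rfl | rfl
    · exact hM.not_linked_of_adj hG.isAcyclic hdeg ha ht hb hst (h1 _ ha) (h1 _ ht) hne.2.symm hab
    · exact hM.not_linked_of_adj hG.isAcyclic hdeg ha hs hb hst.symm (h1 _ ha) (h1 _ hs)
        hne.1.symm hab)
  have hUc : Uᶜ = {s, t} := by
    ext x
    simp only [mem_compl, mem_insert, mem_singleton]
    exact ⟨(key x).1, by rintro (rfl | rfl) <;> assumption⟩
  have hV : Fintype.card V = 6 := by
    rw [← card_add_card_compl U, hcard, hUc, card_pair hst.ne]
  obtain ⟨a, b, ha, hb, -, hsa, hsb, hab⟩ := exists_filter_adj_eq_pair (hdeg s hs)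
  obtain ⟨c, d, hc, hd, -, htc, htd, hcd⟩ := exists_filter_adj_eq_pair (hdeg t ht)
  have hts : ∀ {u}, G.Adj s u → ¬ G.Adj t u := fun h h' =>
    hG.isAcyclic.not_adj_of_common_neighbor h h'.symm hst
  have hst' : ∀ {u}, G.Adj t u → ¬ G.Adj s u := fun h h' => hts h' h
  -- Surjectivity suffices since `V` has six elements; it also yields that all six vertices are
  -- distinct.
  have hsurj : Function.Surjective ![s, t, a, b, c, d] := by
    intro x
    by_cases hx : x ∈ U
    · obtain ⟨y, -, rfl | rfl, hyx⟩ := (key x).2 hx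
      · rcases hab x hx hyx with rfl | rfl
        exacts [⟨2, rfl⟩, ⟨3, rfl⟩]
      · rcases hcd x hx hyx with rfl | rfl
        exacts [⟨4, rfl⟩, ⟨5, rfl⟩]
    · rcases (key x).1 hx with rfl | rfl
      exacts [⟨0, rfl⟩, ⟨1, rfl⟩]
  have hbij := (Fintype.bijective_iff_surjective_and_card _).2 ⟨hsurj, by simp [hV]⟩
  refine ⟨Iso.symm ⟨Equiv.ofBijective _ hbij, fun {i j} => ?_⟩⟩
  have h1 := hts hsa
  have h2 := hts hsb
  have h3 := hst' htc
  have h4 := hst' htd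
  fin_cases i <;> fin_cases j <;>
    simp [sixVertexTree, hst, hst.symm, hsa, hsa.symm, hsb, hsb.symm, htc, htc.symm, htd,
      htd.symm, h1, h2, h3, h4, G.adj_comm _ s, G.adj_comm _ t, hU _ ha _ hb, hU _ ha _ hc,
      hU _ ha _ hd, hU _ hb _ ha, hU _ hb _ hc, hU _ hb _ hd, hU _ hc _ ha, hU _ hc _ hb,
      hU _ hc _ hd, hU _ hd _ ha, hU _ hd _ hb, hU _ hd _ hc]

/-! ### The spectrum of the six-vertex tree -/

instance : DecidableRel sixVertexTree.Adj := fun _ _ => by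
  unfold sixVertexTree
  infer_instance

lemma isTree_sixVertexTree : sixVertexTree.IsTree := by
  rw [isTree_iff_connected_and_card]
  constructor
  · have h : ∀ i j, sixVertexTree.Adj i j → sixVertexTree.Reachable i j := fun i j h => h.reachable
    have h01 := h 0 1 (by decide)
    rw [connected_iff_exists_forall_reachable]
    refine ⟨0, fun i => ?_⟩
    fin_cases i
    exacts [.refl _, h01, h 0 2 (by decide), h 0 3 (by decide), h01.trans (h 1 4 (by decide)),
      h01.trans (h 1 5 (by decide))]
  · rw [Nat.card_eq_fintype_card, ← edgeFinset_card, Nat.card_eq_fintype_card]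
    decide

lemma adjMatrix_sixVertexTree_mulVec (w : Fin 6 → ℝ) : sixVertexTree.adjMatrix ℝ *ᵥ w =
    ![w 1 + w 2 + w 3, w 0 + w 4 + w 5, w 0, w 0, w 1, w 1] := by
  ext i
  rw [adjMatrix_mulVec_apply_eq_sum, Fin.sum_univ_six]
  fin_cases i <;> simp [sixVertexTree]

lemma Iso.adjMatrix_mulVec_symm_apply {V : Type*} [Fintype V] {G : SimpleGraph V}
    [DecidableRel G.Adj] (e : G ≃g sixVertexTree) (z : V → ℝ) (i : Fin 6) :
    (G.adjMatrix ℝ *ᵥ z) (e.symm i) = (sixVertexTree.adjMatrix ℝ *ᵥ (z ∘ e.symm)) i := by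
  rw [adjMatrix_mulVec_apply_eq_sum, adjMatrix_mulVec_apply_eq_sum, ← e.symm.toEquiv.sum_comp]
  refine sum_congr rfl fun j _ => ?_
  simp [Iso.map_adj_iff]

/-- For `r ≠ 0` the leaf coordinates are determined by the two centres, and eliminating them gives
`(r ^ 2 - 2) ^ 2 = r ^ 2`, so `r` is `±1` or `±2`. -/
theorem Iso.isIntegralGraph_of_sixVertexTree (e : G ≃g sixVertexTree) : G.IsIntegralGraph := by
  intro r hr
  obtain ⟨z, hz, hzr⟩ := Matrix.isRoot_charpoly_iff_exists_mulVec_eq_smul.1 hr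
  have hw := fun i => e.adjMatrix_mulVec_symm_apply z i
  rw [hzr, adjMatrix_sixVertexTree_mulVec] at hw
  set w : Fin 6 → ℝ := z ∘ e.symm with hwz
  have hw0 : w ≠ 0 := fun h => hz (funext fun v => by simpa [hwz] using congrFun h (e v))
  have h : ∀ i, r * w i = _ := hw
  have h0 := h 0
  have h1 := h 1
  have h2 := h 2
  have h3 := h 3
  have h4 := h 4
  have h5 := h 5
  simp at h0 h1 h2 h3 h4 h5
  by_cases hr0 : r = 0
  · exact ⟨0, by simp [hr0]⟩
  have e0 : (r ^ 2 - 2) * w 0 = r * w 1 := by linear_combination r * h0 + h2 + h3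
  have e1 : (r ^ 2 - 2) * w 1 = r * w 0 := by linear_combination r * h1 + h4 + h5
  have hprod : ((r ^ 2 - 2) ^ 2 - r ^ 2) = 0 := by
    by_contra hne
    have f0 : w 0 = 0 := by
      refine (mul_eq_zero.1 ?_).resolve_left hne
      linear_combination (r ^ 2 - 2) * e0 + r * e1
    have f1 : w 1 = 0 := by
      refine (mul_eq_zero.1 ?_).resolve_left hne
      linear_combination (r ^ 2 - 2) * e1 + r * e0
    apply hw0
    ext i
    fin_cases i
    exacts [f0, f1, (mul_eq_zero.1 (h2.trans f0)).resolve_left hr0,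
      (mul_eq_zero.1 (h3.trans f0)).resolve_left hr0,
      (mul_eq_zero.1 (h4.trans f1)).resolve_left hr0,
      (mul_eq_zero.1 (h5.trans f1)).resolve_left hr0]
  have hfac : (r - 2) * ((r + 2) * ((r - 1) * (r + 1))) = 0 := by linear_combination hprod
  simp only [mul_eq_zero] at hfac
  rcases hfac with h | h | h | h
  exacts [⟨2, by push_cast; linarith⟩, ⟨-2, by push_cast; linarith⟩, ⟨1, by push_cast; linarith⟩,
    ⟨-1, by push_cast; linarith⟩]

/-- A kernel vector vanishes at the centres and has opposite values on the two leaves of each, so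
one leaf per centre determines it. The lower bound is the dimension count with `U` the four leaves.
-/
theorem Iso.nullity_of_sixVertexTree (e : G ≃g sixVertexTree) : G.nullity = 2 := by
  apply le_antisymm
  · let f : LinearMap.ker (Matrix.toLin' (G.adjMatrix ℝ)) →ₗ[ℝ] ℝ × ℝ :=
      ((LinearMap.proj (e.symm 2)).prod (LinearMap.proj (e.symm 4))).comp (Submodule.subtype _)
    have hf : Function.Injective f := by
      rw [← LinearMap.ker_eq_bot, LinearMap.ker_eq_bot']
      rintro ⟨z, hz⟩ hfz
      have hw := fun i => e.adjMatrix_mulVec_symm_apply z i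
      rw [LinearMap.mem_ker, Matrix.toLin'_apply] at hz
      rw [hz, adjMatrix_sixVertexTree_mulVec] at hw
      have g2 : z (e.symm 2) = 0 := congrArg Prod.fst hfz
      have g4 : z (e.symm 4) = 0 := congrArg Prod.snd hfz
      have h0 := hw 0
      have h1 := hw 1
      have h2 := hw 2
      have h4 := hw 4
      simp [g2, g4] at h0 h1 h2 h4
      have h : ∀ i, z (e.symm i) = 0 := by
        intro i
        fin_cases i <;> simp_all
      ext v
      simpa using h (e v)
    simpa [nullity] using LinearMap.finrank_le_finrank_of_injective hf
  · have h := card_le_two_mul_card_compl_add_nullity (G := G) (U := {e.symm 0, e.symm 1}ᶜ) (by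
      have h6 : ∀ i j, sixVertexTree.Adj i j → i = 0 ∨ i = 1 ∨ j = 0 ∨ j = 1 := by decide
      intro u hu v hv huv
      simp only [mem_compl, mem_insert, mem_singleton, not_or] at hu hv
      have h0 : ∀ {x i}, x ≠ e.symm i → e x ≠ i := fun h h' => h (by simp [← h'])
      rcases h6 _ _ (e.map_adj_iff.2 huv) with h | h | h | h
      exacts [h0 hu.1 h, h0 hu.2 h, h0 hv.1 h, h0 hv.2 h])
    rw [compl_compl, Fintype.card_congr e.toEquiv, Fintype.card_fin] at h
    have := card_le_two (a := e.symm 0) (b := e.symm 1)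
    omega

end SimpleGraph

/-! ### A vertex with three neighbours in `U` -/

namespace SimpleGraph

variable {V : Type*} [DecidableEq V] {G : SimpleGraph V} [DecidableRel G.Adj]
  {U : Finset V} {s t : V}

/-- If `o` and `t` were not linked, the vector `(1, -2, 2)` would give at most `10 - 4 - 8 < 0`. -/
lemma SchurNonneg.linked_trans (hM : G.SchurNonneg U) {o : V} (ho : o ∉ U) (hs : s ∉ U) (ht : t ∉ U)
    (hdo : G.degreeIn U o = 3) (hds : G.degreeIn U s = 2) (hdt : G.degreeIn U t = 2)
    (hos : G.Linked U o s) (hst : G.Linked U s t) (hot : o ≠ t) : G.Linked U o t := by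
  by_contra h
  have h1 := hos.one_le_schurEntry
  have h2 := hst.one_le_schurEntry
  have h3 := schurEntry_eq_zero hot h
  have h4 := hM 3 ![o, s, t] ![1, -2, 2] (by intro i; fin_cases i <;> simpa)
  simp only [Fin.sum_univ_three, Matrix.cons_val_zero, Matrix.cons_val_one, Matrix.cons_val,
    schurEntry_self, hdo, hds, hdt, h3, G.schurEntry_comm (s := t) (t := s),
    G.schurEntry_comm (s := s) (t := o), G.schurEntry_comm (s := t) (t := o)] at h4
  norm_num at h4
  linarith

/-- The vector `(1, -1, -1, -1)` gives at most `2 + 3 - 6 < 0`. -/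
lemma SchurNonneg.not_three_linked (hM : G.SchurNonneg U) {o a b c : V} (ho : o ∉ U) (ha : a ∉ U)
    (hb : b ∉ U) (hc : c ∉ U) (hdo : G.degreeIn U o = 3) (hda : G.degreeIn U a = 2)
    (hdb : G.degreeIn U b = 2) (hdc : G.degreeIn U c = 2) (hoa : G.Linked U o a)
    (hob : G.Linked U o b) (hoc : G.Linked U o c) (hab : a ≠ b) (hac : a ≠ c) (hbc : b ≠ c)
    (hnab : ¬ G.Linked U a b) (hnac : ¬ G.Linked U a c) (hnbc : ¬ G.Linked U b c) : False := by
  have h1 := hoa.one_le_schurEntry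
  have h2 := hob.one_le_schurEntry
  have h3 := hoc.one_le_schurEntry
  have h4 := schurEntry_eq_zero hab hnab
  have h5 := schurEntry_eq_zero hac hnac
  have h6 := schurEntry_eq_zero hbc hnbc
  have h7 := hM 4 ![o, a, b, c] ![1, -1, -1, -1] (by intro i; fin_cases i <;> simpa)
  simp only [Fin.sum_univ_four, Matrix.cons_val_zero, Matrix.cons_val_one, Matrix.cons_val,
    schurEntry_self, hdo, hda, hdb, hdc, h4, h5, h6, G.schurEntry_comm (s := b) (t := a),
    G.schurEntry_comm (s := c) (t := a), G.schurEntry_comm (s := c) (t := b),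
    G.schurEntry_comm (s := a) (t := o), G.schurEntry_comm (s := b) (t := o),
    G.schurEntry_comm (s := c) (t := o)] at h7
  norm_num at h7
  linarith

lemma exists_filter_adj_eq_insert {d : V} (h : G.degreeIn U s = 2) (hd : d ∈ U)
    (hsd : G.Adj s d) : ∃ w ∈ U, w ≠ d ∧ G.Adj s w ∧ {u ∈ U | G.Adj s u} = {d, w} := by
  obtain ⟨a, b, ha, hb, hab, hsa, hsb, h⟩ := exists_filter_adj_eq_pair h
  have key : {u ∈ U | G.Adj s u} = {a, b} := by
    ext u
    simp only [mem_filter, mem_insert, mem_singleton]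
    exact ⟨fun hu => h u hu.1 hu.2, by rintro (rfl | rfl) <;> exact ⟨‹_›, ‹_›⟩⟩
  rcases h d hd hsd with rfl | rfl
  · exact ⟨b, hb, hab.symm, hsb, key⟩
  · exact ⟨a, ha, hab, hsa, by rw [key, pair_comm]⟩

variable [Fintype V]

/-- In an integral bipartite graph, the nonzero singular values of the biadjacency matrix are
integers. -/
lemma IsIntegralGraph.exists_int_of_biadjacency (hG : G.IsIntegralGraph)
    (hU : ∀ u ∈ U, ∀ v ∈ U, ¬ G.Adj u v) (hS : ∀ s ∉ U, ∀ t ∉ U, ¬ G.Adj s t) {x : V → ℝ} {r : ℝ}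
    (hr : r ≠ 0) (hx : ∃ s ∉ U, x s ≠ 0)
    (h : ∀ s ∉ U, ∑ u ∈ U with G.Adj s u, ∑ t ∈ Uᶜ with G.Adj t u, x t = r ^ 2 * x s) :
    ∃ k : ℤ, r = k := by
  -- For the biadjacency matrix `B`, with rows indexed by `Uᶜ`, the equation `B Bᵀ x = r ^ 2 x`
  -- makes `(r x, Bᵀ x)` an eigenvector of the graph for `r`.
  set z : V → ℝ := fun v => if v ∈ U then ∑ t ∈ Uᶜ with G.Adj t v, x t else r * x v with hz
  obtain ⟨s, hs, hxs⟩ := hx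
  refine hG.exists_int_of_mulVec_eq (z := z) (fun h0 => ?_) ?_
  · have := congrFun h0 s
    simp [hz, hs, hr, hxs] at this
  · ext v
    rw [adjMatrix_mulVec_apply, neighborFinset_eq_filter, Pi.smul_apply, smul_eq_mul]
    by_cases hv : v ∈ U
    · have h1 : ({w | G.Adj v w} : Finset V) = ({t ∈ Uᶜ | G.Adj t v} : Finset V) := by
        ext w
        simp only [mem_filter, mem_univ, true_and, mem_compl, G.adj_comm w]
        exact ⟨fun h => ⟨fun hw => hU v hv w hw h, h⟩, fun h => h.2⟩
      rw [h1, hz]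
      simp only [if_pos hv, mul_sum]
      refine sum_congr rfl fun w hw => ?_
      simp only [mem_filter, mem_compl] at hw
      rw [if_neg hw.1]
    · have h1 : ({w | G.Adj v w} : Finset V) = ({u ∈ U | G.Adj v u} : Finset V) := by
        ext w
        simp only [mem_filter, mem_univ, true_and]
        exact ⟨fun h => ⟨by_contra fun hw => hS v hv w hw h, h⟩, fun h => h.2⟩
      rw [h1]
      have h2 : r * z v = r ^ 2 * x v := by
        simp only [hz, if_neg hv]
        ring
      rw [h2, ← h v hv]
      refine sum_congr rfl fun u hu => ?_
      simp only [hz, if_pos (mem_filter.1 hu).1]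

/-- An eigenvalue condition for trees that consist of a vertex `o` with neighbours `d₁`, `d₂`, `d₃`
and of pendant paths of length two at `d₁` and `d₂`. -/
lemma IsIntegralGraph.exists_int_of_spider (hG : G.IsIntegralGraph) (hT : G.IsAcyclic)
    (hU : ∀ u ∈ U, ∀ v ∈ U, ¬ G.Adj u v) (hS : ∀ s ∉ U, ∀ t ∉ U, ¬ G.Adj s t) {o d₁ d₂ d₃ : V}
    (ho : o ∉ U) (hd : {u ∈ U | G.Adj o u} = {d₁, d₂, d₃}) (h12 : d₁ ≠ d₂) (h13 : d₁ ≠ d₃)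
    (h23 : d₂ ≠ d₃) (hdeg : ∀ s ∉ U, s ≠ o → G.degreeIn U s = 2)
    (hcov : ∀ s ∉ U, s ≠ o → G.Adj s d₁ ∨ G.Adj s d₂) (hd3 : ∀ s ∉ U, s ≠ o → ¬ G.Adj s d₃)
    {c α β r : ℝ} (hr : r ≠ 0)
    (hne : c ≠ 0 ∨ α ≠ 0 ∧ 0 < #{t ∈ Uᶜ | t ≠ o ∧ G.Adj t d₁})
    (hα : c + (#{t ∈ Uᶜ | t ≠ o ∧ G.Adj t d₁} + 1) * α = r ^ 2 * α)
    (hβ : c + (#{t ∈ Uᶜ | t ≠ o ∧ G.Adj t d₂} + 1) * β = r ^ 2 * β)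
    (hc : 3 * c + #{t ∈ Uᶜ | t ≠ o ∧ G.Adj t d₁} * α + #{t ∈ Uᶜ | t ≠ o ∧ G.Adj t d₂} * β =
      r ^ 2 * c) : ∃ k : ℤ, r = k := by
  have hmem : ∀ u, u ∈ U ∧ G.Adj o u ↔ u = d₁ ∨ u = d₂ ∨ u = d₃ := fun u => by
    rw [← mem_filter, hd]
    simp
  obtain ⟨hd1U, hod1⟩ := (hmem d₁).2 (by simp)
  obtain ⟨hd2U, hod2⟩ := (hmem d₂).2 (by simp)
  obtain ⟨hd3U, hod3⟩ := (hmem d₃).2 (by simp)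
  have hexcl : ∀ s, s ≠ o → G.Adj s d₁ → ¬ G.Adj s d₂ := fun s hso h1 h2 =>
    h12 (hT.eq_of_common_neighbors hso h1 hod1.symm h2 hod2.symm)
  -- Outside `U`, the vector is constant on `o` and on each of the two branches, so the eigenvalue
  -- equation reduces to three scalar ones.
  set x : V → ℝ := fun s => if s = o then c else if G.Adj s d₁ then α else β with hx
  have hx1 : ∀ s, s ≠ o → G.Adj s d₁ → x s = α := fun s hso h => by simp [hx, hso, h]
  have hx2 : ∀ s, s ≠ o → G.Adj s d₂ → x s = β := fun s hso h => by
    have h1 : ¬ G.Adj s d₁ := fun h1 => hexcl s hso h1 h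
    simp [hx, hso, h1]
  have hxo : x o = c := by simp [hx]
  have hT' : ∀ d a, G.Adj o d → (∀ s, s ≠ o → G.Adj s d → x s = a) →
      ∑ t ∈ Uᶜ with G.Adj t d, x t = c + #{t ∈ Uᶜ | t ≠ o ∧ G.Adj t d} * a := by
    intro d a hod ha
    have h1 : ({t ∈ Uᶜ | G.Adj t d} : Finset V) = insert o {t ∈ Uᶜ | t ≠ o ∧ G.Adj t d} := by
      ext t
      by_cases hto : t = o
      · simp [hto, ho, hod]
      · simp [hto]
    rw [h1, sum_insert (by simp), hxo, sum_congr rfl (g := fun _ => a), sum_const, nsmul_eq_mul]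
    intro t ht
    simp only [mem_filter] at ht
    exact ha t ht.2.1 ht.2.2
  have hT1 := hT' d₁ α hod1 hx1
  have hT2 := hT' d₂ β hod2 hx2
  have hT3 : ∑ t ∈ Uᶜ with G.Adj t d₃, x t = c := by
    rw [sum_eq_single_of_mem o (by simp [ho, hod3]), hxo]
    intro t ht hto
    simp only [mem_filter, mem_compl] at ht
    exact absurd ht.2 (hd3 t ht.1 hto)
  -- The second neighbour `w` of `s` in `U` is a leaf: any further neighbour would close a cycle of
  -- length four or six with `o` or a `dᵢ`. It therefore contributes just `x s`.
  have hother : ∀ s ∉ U, s ≠ o → ∀ d, G.Adj o d → d ∈ U → G.Adj s d →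
      ∑ u ∈ U with G.Adj s u, ∑ t ∈ Uᶜ with G.Adj t u, x t =
        ∑ t ∈ Uᶜ with G.Adj t d, x t + x s := by
    intro s hs hso d hod hdU hsd
    obtain ⟨w, hwU, hwd, hsw, hw⟩ := exists_filter_adj_eq_insert (hdeg s hs hso) hdU hsd
    rw [hw, sum_pair hwd.symm, sum_eq_single_of_mem (s := {t ∈ Uᶜ | G.Adj t w}) s (by simp [hs, hsw])]
    intro t ht hts
    simp only [mem_filter, mem_compl] at ht
    by_cases hto : t = o
    · subst hto
      exact absurd (hT.eq_of_common_neighbors hso hsw ht.2.symm hsd hod.symm) hwd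
    · have h1 : ∀ e, G.Adj o e → ¬ G.Adj t e := fun e hoe hte => by
        have h2 := hT.eq_of_path_four hsw ht.2.symm hte hoe.symm hsd hod.symm hts.symm hto hso
        subst h2
        exact hwd (hT.eq_of_common_neighbors hts.symm hsw ht.2.symm hsd hte.symm)
      rcases hcov t ht.1 hto with h | h
      exacts [absurd h (h1 _ hod1), absurd h (h1 _ hod2)]
  refine hG.exists_int_of_biadjacency hU hS hr (x := x) ?_ ?_
  · rcases hne with h | ⟨h, hpos⟩
    · exact ⟨o, ho, by rwa [hxo]⟩
    · obtain ⟨t, ht⟩ := card_pos.1 hpos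
      simp only [mem_filter, mem_compl] at ht
      exact ⟨t, ht.1, by rwa [hx1 t ht.2.1 ht.2.2]⟩
  · intro s hs
    by_cases hso : s = o
    · rw [hso, hd, sum_insert (by simp [h12, h13]), sum_pair h23, hT1, hT2, hT3, hxo, ← hc]
      ring
    · rcases hcov s hs hso with h | h
      · rw [hother s hs hso d₁ hod1 hd1U h, hT1, hx1 s hso h, ← hα]
        ring
      · rw [hother s hs hso d₂ hod2 hd2U h, hT2, hx2 s hso h, ← hβ]
        ring

lemma IsIntegralGraph.false_of_spider (hG : G.IsIntegralGraph) (hT : G.IsAcyclic)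
    (hU : ∀ u ∈ U, ∀ v ∈ U, ¬ G.Adj u v) (hS : ∀ s ∉ U, ∀ t ∉ U, ¬ G.Adj s t) {o d₁ d₂ d₃ : V}
    (ho : o ∉ U) (hd : {u ∈ U | G.Adj o u} = {d₁, d₂, d₃}) (h12 : d₁ ≠ d₂) (h13 : d₁ ≠ d₃)
    (h23 : d₂ ≠ d₃) (hdeg : ∀ s ∉ U, s ≠ o → G.degreeIn U s = 2)
    (hcov : ∀ s ∉ U, s ≠ o → G.Adj s d₁ ∨ G.Adj s d₂)
    (hd3 : ∀ s ∉ U, s ≠ o → ¬ G.Adj s d₃) : False := by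
  have key := fun (c α β r : ℝ) => hG.exists_int_of_spider hT hU hS ho hd h12 h13 h23 hdeg hcov hd3
    (c := c) (α := α) (β := β) (r := r)
  generalize #{t ∈ Uᶜ | t ≠ o ∧ G.Adj t d₁} = p at key
  generalize #{t ∈ Uᶜ | t ≠ o ∧ G.Adj t d₂} = q at key
  by_cases hpq : p = q
  · subst hpq
    -- The vector symmetric in the branches has `r ^ 2 = p + 3`, and the antisymmetric one below has
    -- `r ^ 2 = p + 1`. Two squares never differ by 2, modulo 4.
    obtain ⟨k, hk⟩ : ∃ k : ℤ, (p : ℤ) + 3 = k ^ 2 := by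
      have hsq : √((p : ℝ) + 3) ^ 2 = p + 3 := Real.sq_sqrt (by positivity)
      obtain ⟨k, hk⟩ := key 1 (1 / 2) (1 / 2) √(p + 3) (by positivity) (by simp)
        (by rw [hsq]; ring) (by rw [hsq]; ring) (by rw [hsq]; ring)
      rw [hk] at hsq
      exact ⟨k, by exact_mod_cast hsq.symm⟩
    obtain ⟨m, hm⟩ : ∃ m : ℤ, (p : ℤ) + 1 = m ^ 2 := by
      rcases Nat.eq_zero_or_pos p with rfl | hp
      · exact ⟨1, by simp⟩
      have hsq : √((p : ℝ) + 1) ^ 2 = p + 1 := Real.sq_sqrt (by positivity)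
      obtain ⟨m, hm⟩ := key 0 1 (-1) √(p + 1) (by positivity) (by simp [hp])
        (by rw [hsq]; ring) (by rw [hsq]; ring) (by rw [hsq]; ring)
      rw [hm] at hsq
      exact ⟨m, by exact_mod_cast hsq.symm⟩
    have h2 : k ^ 2 = m ^ 2 + 2 := by omega
    rcases Int.even_or_odd' k with ⟨a, rfl | rfl⟩ <;> rcases Int.even_or_odd' m with ⟨b, rfl | rfl⟩ <;>
      ring_nf at h2 <;> omega
  · have hD : 0 ≤ ((p : ℝ) - q) ^ 2 + 4 := by positivity
    -- With `c = 1` the branch equations give `α = 1 / (y - (p + 1))` and `β = 1 / (y - (q + 1))`.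
    -- The equation at `o` then becomes this quadratic, up to the factor `y - 1`; the witness is the
    -- larger root.
    obtain ⟨y, hy0, hy⟩ : ∃ y : ℝ, 0 < y ∧ (y - (p + 2)) * (y - (q + 2)) = 1 := by
      refine ⟨(p + q + 4 + √(((p : ℝ) - q) ^ 2 + 4)) / 2, by positivity, ?_⟩
      linear_combination (1 / 4) * Real.sq_sqrt hD
    have hpq' : (p : ℝ) ≠ q := by exact_mod_cast hpq
    have hp : y - (p + 1) ≠ 0 := fun h => hpq' (by
      have : y = p + 1 := by linarith
      subst this
      linarith)
    have hq : y - (q + 1) ≠ 0 := fun h => hpq' (by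
      have : y = q + 1 := by linarith
      subst this
      linarith)
    have hsq : √y ^ 2 = y := Real.sq_sqrt hy0.le
    obtain ⟨k, hk⟩ := key 1 (1 / (y - (p + 1))) (1 / (y - (q + 1))) √y (by positivity) (by simp)
      (by rw [hsq]; field_simp; ring) (by rw [hsq]; field_simp; ring) (by
        rw [hsq]
        field_simp
        linear_combination (-(y - 1)) * hy)
    rw [hk] at hsq
    rw [← hsq] at hy
    have hy' : (k ^ 2 - ((p : ℤ) + 2)) * (k ^ 2 - (q + 2)) = 1 := by exact_mod_cast hy
    -- The integer factors are both 1 or both -1, hence equal, which contradicts `p ≠ q`.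
    rcases Int.mul_eq_one_iff_eq_one_or_neg_one.1 hy' with h | h <;> omega

/-- By `linked_trans` every other vertex outside `U` is linked to `o`, through one of its three
neighbours in `U`. By `not_three_linked` one of these neighbours is a leaf, and `false_of_spider`
applies. -/
theorem IsTree.degreeIn_ne_three (hG : G.IsTree) (hint : G.IsIntegralGraph)
    (hU : ∀ u ∈ U, ∀ v ∈ U, ¬ G.Adj u v) (hS : ∀ s ∉ U, ∀ t ∉ U, ¬ G.Adj s t)
    (hM : G.SchurNonneg U) {o : V} (ho : o ∉ U) (hdeg : ∀ s ∉ U, s ≠ o → G.degreeIn U s = 2) :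
    G.degreeIn U o ≠ 3 := by
  intro hdo
  have hT := hG.isAcyclic
  have key := hG.connected.induction_linked hU (P := fun s => s = o ∨ G.Linked U o s) ho (Or.inl rfl)
    (by
      intro a b ha hb hP hab
      by_cases hbo : b = o
      · exact Or.inl hbo
      rcases hP with rfl | hP
      · exact Or.inr hab
      · exact Or.inr (hM.linked_trans ho ha hb hdo (hdeg a ha hP.1.symm) (hdeg b hb hbo) hP hab
          (Ne.symm hbo)))
  obtain ⟨d₁, d₂, d₃, h12, h13, h23, hd⟩ := card_eq_three.1 hdo
  have hmem : ∀ u, u ∈ U ∧ G.Adj o u ↔ u = d₁ ∨ u = d₂ ∨ u = d₃ := fun u => by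
    rw [← mem_filter, hd]
    simp
  have hcov : ∀ s ∉ U, s ≠ o → G.Adj s d₁ ∨ G.Adj s d₂ ∨ G.Adj s d₃ := by
    intro s hs hso
    obtain ⟨u, hu, hou, hsu⟩ := (((key s).1 hs).resolve_left hso).2.resolve_left (hS o ho s hs)
    rcases (hmem u).1 ⟨hu, hou⟩ with rfl | rfl | rfl
    exacts [Or.inl hsu, Or.inr (Or.inl hsu), Or.inr (Or.inr hsu)]
  have hempty : (∀ s ∉ U, s ≠ o → ¬ G.Adj s d₁) ∨ (∀ s ∉ U, s ≠ o → ¬ G.Adj s d₂) ∨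
      ∀ s ∉ U, s ≠ o → ¬ G.Adj s d₃ := by
    by_contra! h
    obtain ⟨⟨a, ha, hao, had⟩, ⟨b, hb, hbo, hbd⟩, ⟨c, hc, hco, hcd⟩⟩ := h
    obtain ⟨hd1U, hod1⟩ := (hmem d₁).2 (by simp)
    obtain ⟨hd2U, hod2⟩ := (hmem d₂).2 (by simp)
    obtain ⟨hd3U, hod3⟩ := (hmem d₃).2 (by simp)
    have hne : ∀ {x y d e}, x ≠ o → d ≠ e → G.Adj o d → G.Adj o e → G.Adj x d → G.Adj y e →
        x ≠ y := by
      rintro x y d e hx hde hod hoe hxd hye rfl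
      exact hde (hT.eq_of_common_neighbors hx hxd hod.symm hye hoe.symm)
    have hnl : ∀ {x y d e}, x ∉ U → y ∉ U → x ≠ o → y ≠ o → d ≠ e → G.Adj o d → G.Adj o e →
        G.Adj x d → G.Adj y e → ¬ G.Linked U x y := by
      intro x y d e hxU hyU hx hy hde hod hoe hxd hye h
      obtain ⟨w, -, hxw, hyw⟩ := h.2.resolve_left (hS x hxU y hyU)
      exact hde (hT.eq_of_path_four hxw hyw.symm hye hoe.symm hxd hod.symm h.1 hy hx)
    exact hM.not_three_linked ho ha hb hc hdo (hdeg a ha hao) (hdeg b hb hbo) (hdeg c hc hco)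
      ⟨hao.symm, Or.inr ⟨d₁, hd1U, hod1, had⟩⟩ ⟨hbo.symm, Or.inr ⟨d₂, hd2U, hod2, hbd⟩⟩
      ⟨hco.symm, Or.inr ⟨d₃, hd3U, hod3, hcd⟩⟩ (hne hao h12 hod1 hod2 had hbd)
      (hne hao h13 hod1 hod3 had hcd) (hne hbo h23 hod2 hod3 hbd hcd)
      (hnl ha hb hao hbo h12 hod1 hod2 had hbd) (hnl ha hc hao hco h13 hod1 hod3 had hcd)
      (hnl hb hc hbo hco h23 hod2 hod3 hbd hcd)
  rcases hempty with h | h | h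
  · refine hint.false_of_spider hT hU hS ho (d₁ := d₂) (d₂ := d₃) (d₃ := d₁) ?_ h23 h12.symm
      h13.symm hdeg (fun s hs hso => (hcov s hs hso).resolve_left (h s hs hso)) h
    rw [hd]
    ext
    simp only [mem_insert, mem_singleton]
    tauto
  · refine hint.false_of_spider hT hU hS ho (d₁ := d₁) (d₂ := d₃) (d₃ := d₂) ?_ h13 h12
      h23.symm hdeg (fun s hs hso => (hcov s hs hso).imp_right
        fun h' => h'.resolve_left (h s hs hso)) h
    rw [hd]
    ext
    simp only [mem_insert, mem_singleton]
    tauto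
  · refine hint.false_of_spider hT hU hS ho hd h12 h13 h23 hdeg (fun s hs hso => ?_) h
    rcases hcov s hs hso with h' | h' | h'
    exacts [Or.inl h', Or.inr h', absurd h' (h s hs hso)]

theorem IsTree.nonempty_iso_sixVertexTree_of_isIntegralGraph (hG : G.IsTree)
    (hint : G.IsIntegralGraph) (hnull : G.nullity = 2) : Nonempty (G ≃g sixVertexTree) := by
  obtain ⟨U, hU, hM, hcard, hdeg, hsum⟩ := hG.exists_indep_schurNonneg hint hnull
  by_cases h2 : ∀ s ∉ U, G.degreeIn U s = 2
  · refine hG.nonempty_iso_sixVertexTree hU hM hcard h2 ?_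
    rw [← hsum]
    refine sum_congr rfl fun s hs => ?_
    rw [h2 s (mem_compl.1 hs)]
    omega
  push Not at h2
  obtain ⟨o, ho, hdo⟩ := h2
  have hdo' := hdeg o ho
  rw [← add_sum_erase _ _ (mem_compl.2 ho)] at hsum
  -- The term of `o` is at least 2 and already exhausts the sum, so `o` has exactly three neighbours
  -- in `U` and none outside.
  have h0 : ∑ s ∈ Uᶜ.erase o, (2 * (G.degreeIn U s - 2) + G.degreeIn Uᶜ s) = 0 := by omega
  have h0' : ∀ s ∉ U, s ≠ o → G.degreeIn U s = 2 ∧ G.degreeIn Uᶜ s = 0 := fun s hs hso => by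
    have := sum_eq_zero_iff.1 h0 s (by simp [hs, hso])
    have := hdeg s hs
    omega
  have hS0 : ∀ s ∉ U, G.degreeIn Uᶜ s = 0 := fun s hs => by
    by_cases hso : s = o
    · subst hso; omega
    · exact (h0' s hs hso).2
  refine absurd (by omega) (hG.degreeIn_ne_three hint hU (fun s hs t ht hst => ?_) hM ho
    fun s hs hso => (h0' s hs hso).1)
  have := card_eq_zero.1 (hS0 s hs)
  have := filter_eq_empty_iff.1 this (mem_compl.2 ht)
  exact this hst

end SimpleGraph

end

theorem mainTheorem6 {V : Type*} [Fintype V] [DecidableEq V] (G : SimpleGraph V)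
    [DecidableRel G.Adj] :
    (G.IsTree ∧ G.IsIntegralGraph ∧ G.nullity = 2) ↔ Nonempty (G ≃g sixVertexTree) :=
  ⟨fun ⟨hG, hint, hnull⟩ => hG.nonempty_iso_sixVertexTree_of_isIntegralGraph hint hnull,
    fun ⟨e⟩ => ⟨e.isTree_iff.2 SimpleGraph.isTree_sixVertexTree, e.isIntegralGraph_of_sixVertexTree,
      e.nullity_of_sixVertexTree⟩⟩
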